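/- Let $d\ge 1$. Throughout, $\nu$ is a symmetric Lévy measure on $\mathbb R^d$ with infinite mass, i.e. a Borel measure with $\nu(\{0\})=0$, $\int(1\wedge|y|^2)\,\nu(dy)<\infty$, $\nu(-D)=\nu(D)$ for all Borel sets $D$, and $\nu(\mathbb R^d)=\infty$. Put $$\Phi(\xi)=\int_{\mathbb R^d}\bigl(1-\cos(\xi\cdot y)\bigr)\,\nu(dy),\qquad \Psi(r)=\sup_{|\xi|\le r}\Phi(\xi),\qquad \Psi^{-1}(s)=\sup\{r>0:\Psi(r)=s\},\qquad h(t)=\frac1{\Psi^{-1}(1/t)},$$ and let $(P_t)_{t\ge0}$ be the convolution semigroup of probability measures on $\mathbb R^d$ with $\int e^{i\xi\cdot y}\,P_t(dy)=e^{-t\Phi(\xi)}$. Given $M_0>0$ and $t_p\in(0,\infty]$, consider the condition $$\text{(A1)}\qquad \int_{\mathbb R^d}e^{-t\Phi(\xi)}|\xi|\,d\xi\le M_0\,h(t)^{-d-1}\qquad\text{for all } t\in(0,t_p).$$ Lemma. There is a constant $c_1=c_1(d)>0$ and, for every $\eta>0$ and $M_0>0$, there is a constant $c_2=c_2(d,\eta,M_0)>0$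 such that the following holds. Let $\nu$ be as above and satisfy (A1) with $M_0$ and some $t_p\in(0,\infty]$, and let $r_0,\kappa_0>0$ be such that the density $d\nu_c/dm$ with respect to Lebesgue measure $m$ of the absolutely continuous part $\nu_c$ of $\nu$ satisfies $\frac{d\nu_c}{dm}(x)\ge\kappa_0$ for almost every $x\in B(0,r_0)$. Then the semigroup $(P_t)_{t\ge 0}$ exists, for every $t>0$ the measure $P_t$ has a continuous density $p_t$, and $$p_t(x)\ \ge\ c_1\,r_0^{-d}\exp\left\{-\frac{2|x|}{r_0}\log\left(\frac{c_2|x|}{r_0^{d+1}\kappa_0\,t}\right)\right\}$$ for all $t\in(0,t_p)$ and all $x\in\mathbb R^d$ with $|x|\ge\max\left\{r_0,\ \Psi\left(\frac{6\eta}{r_0}\right)\frac{3r_0}{4}\,t\right\}$. -/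

import Mathlib

open MeasureTheory
open scoped NNReal ENNReal Pointwise

noncomputable section

namespace LevyLower

variable {d : ℕ}

/-- A symmetric Lévy measure on `ℝ^d` (no mass at the origin) of infinite total mass. -/
structure IsSymmLevyMeasure (ν : Measure (EuclideanSpace ℝ (Fin d))) : Prop where
  zero_singleton : ν {0} = 0
  levy : ∫⁻ y, ENNReal.ofReal (min 1 (‖y‖ ^ 2)) ∂ν < ∞
  symm : ∀ D : Set (EuclideanSpace ℝ (Fin d)), MeasurableSet D → ν (-D) = ν D
  infinite : ν Set.univ = ∞

/-- The characteristic exponent `Φ(ξ) = ∫ (1 - cos ⟨ξ, y⟩) ν(dy)`. -/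
def levyExponent (ν : Measure (EuclideanSpace ℝ (Fin d)))
    (ξ : EuclideanSpace ℝ (Fin d)) : ℝ :=
  ∫ y, (1 - Real.cos (inner ℝ ξ y)) ∂ν

/-- `Ψ(r) = sup_{|ξ| ≤ r} Φ(ξ)`. -/
def levyPsi (ν : Measure (EuclideanSpace ℝ (Fin d))) (r : ℝ) : ℝ :=
  sSup (levyExponent ν '' Metric.closedBall 0 r)

/-- The generalized inverse `Ψ⁻¹(s) = sup {r > 0 : Ψ(r) = s}`. -/
def levyPsiInv (ν : Measure (EuclideanSpace ℝ (Fin d))) (s : ℝ) : ℝ :=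
  sSup {r : ℝ | 0 < r ∧ levyPsi ν r = s}

/-- `h(t) = 1 / Ψ⁻¹(1 / t)`. -/
def levyScale (ν : Measure (EuclideanSpace ℝ (Fin d))) (t : ℝ) : ℝ :=
  1 / levyPsiInv ν (1 / t)

/-- The condition
`∫ exp(-t Φ(ξ)) |ξ| dξ ≤ M₀ h(t)^(-d-1)` for all `t ∈ (0, t_p)`, where `t_p ∈ (0, ∞]`. -/
def CondA1 (ν : Measure (EuclideanSpace ℝ (Fin d))) (M₀ : ℝ) (tp : ℝ≥0∞) : Prop :=
  ∀ t : ℝ≥0, 0 < t → (t : ℝ≥0∞) < tp →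
    ∫⁻ ξ : EuclideanSpace ℝ (Fin d),
        ENNReal.ofReal (Real.exp (-(t : ℝ) * levyExponent ν ξ) * ‖ξ‖)
      ≤ ENNReal.ofReal (M₀ * (levyScale ν t) ^ (-(d : ℤ) - 1))

/-- `(P_t)_{t ≥ 0}` is the convolution semigroup of probability measures with
Fourier transform `exp(-t Φ)`. -/
structure IsLevySemigroup (ν : Measure (EuclideanSpace ℝ (Fin d)))
    (P : ℝ≥0 → Measure (EuclideanSpace ℝ (Fin d))) : Prop where
  prob : ∀ t, IsProbabilityMeasure (P t)
  zero : P 0 = Measure.dirac 0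
  add : ∀ s t, P (s + t) = (P s).conv (P t)
  charFun_eq : ∀ t ξ, charFun (P t) ξ = (Real.exp (-(t : ℝ) * levyExponent ν ξ) : ℂ)

/-- `p` is the continuous density of `μ` with respect to Lebesgue measure; such a `p` is unique,
so that its values at points are meaningful. -/
structure IsContinuousDensity (μ : Measure (EuclideanSpace ℝ (Fin d)))
    (p : EuclideanSpace ℝ (Fin d) → ℝ) : Prop where
  continuous : Continuous p
  nonneg : ∀ x, 0 ≤ p x
  eq_withDensity : μ = (volume : Measure (EuclideanSpace ℝ (Fin d))).withDensity
    (fun x => ENNReal.ofReal (p x))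

end LevyLower

end

/-! The mass near x comes from a chain of about |x|/r₀ jumps, one per time step. Put u = |x|/r₀ and
cut t into N steps of length s = t/N with 4u/3 < N ≤ 2u; the lower bound on |x| then yields s
Ψ(6η/r₀) ≤ 1.

Split off from ν the measure l = κ₀ · Lebesgue on B(0, r₀). Then P_s is the compound Poisson law of
s l convolved with a probability measure Q of exponent s times that of ν - l. The one-jump term of
the Poisson series is e^{-s|l|} s l. The characteristic function of Q is at least e^{-1} for |ξ| ≤
6η/r₀, so Q gives B(0, r₀/8) at least a mass c(d, η) (`exists_le_measureReal_ball`). Hence P_s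
dominates a multiple of Lebesgue measure on B(0, 7r₀/8) (`IsLevySemigroup.ballMeasure_le`);
e^{-s|l|} stays bounded below because Ψ(6η/r₀) controls κ₀ r₀^d (`exists_mul_le_levyPsi`).

Convolving N such bounds reaches radius 3N r₀/4 > |x| at the price of a factor (const · s κ₀ r₀^d)^N
r₀^{-d}, which N ≤ 2u turns into the stated exponential. Condition (A1) makes e^{-tΦ} integrable, so
Fourier inversion gives the continuous density; the semigroup itself is a limit of compound Poisson
laws. -/

namespace LevyLower

/-! ### Fourier inversion, and mass near the origin from the characteristic function. -/

section Fourier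

open FourierTransform SchwartzMap Convolution

variable {E : Type*} [NormedAddCommGroup E] [InnerProductSpace ℝ E] [FiniteDimensional ℝ E]
  [MeasurableSpace E] [BorelSpace E]

-- Reconciles the kernel e^{i⟨x,ξ⟩} of `charFun` with the kernel e^{-2πi⟨x,ξ⟩} of `𝓕`.
omit [FiniteDimensional ℝ E] [BorelSpace E] in
lemma charFun_two_pi_smul (μ : Measure E) (ξ : E) :
    charFun μ ((2 * Real.pi) • ξ) =
      VectorFourier.fourierIntegral Real.fourierChar μ (-innerₗ E) 1 ξ := by
  simp only [charFun_apply, VectorFourier.fourierIntegral, LinearMap.neg_apply,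
    innerₗ_apply_apply, inner_smul_right, neg_neg, Real.fourierChar_apply', Pi.one_apply,
    Circle.smul_def, Circle.coe_exp, Complex.ofReal_mul, smul_eq_mul, mul_one]

/-- The Parseval formula for the integral of a Schwartz function against a finite measure. -/
lemma integral_schwartz_eq_integral_fourier (μ : Measure E) [IsFiniteMeasure μ] (f : 𝓢(E, ℂ)) :
    ∫ x, f x ∂μ = ∫ ξ, charFun μ ((2 * Real.pi) • ξ) * (𝓕 f : 𝓢(E, ℂ)) ξ := by
  have h := VectorFourier.integral_fourierIntegral_smul_eq_flip (μ := μ) (ν := (volume : Measure E))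
    (L := -innerₗ E) (f := 1) (g := (𝓕 f : 𝓢(E, ℂ))) Real.continuous_fourierChar
    (by simp only [LinearMap.neg_apply, innerₗ_apply_apply]; fun_prop)
    (integrable_const (1 : ℂ)) (𝓕 f : 𝓢(E, ℂ)).integrable
  simp only [smul_eq_mul] at h
  simp_rw [charFun_two_pi_smul]
  rw [h]
  refine integral_congr_ae (.of_forall fun x => ?_)
  have h1 : f x = 𝓕⁻ (𝓕 f) x := by rw [FourierTransform.fourierInv_fourier_eq]
  simp only [Pi.one_apply, one_mul]
  rw [h1, fourierInv_coe, Real.fourierInv_eq]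
  simp [VectorFourier.fourierIntegral, real_inner_comm]

/-- The Parseval formula for a finite measure with integrable characteristic function. -/
lemma integral_schwartz_eq_integral_mul (μ : Measure E) [IsFiniteMeasure μ]
    (hμ : Integrable (fun ξ : E => charFun μ ((2 * Real.pi) • ξ))) (f : 𝓢(E, ℂ)) :
    ∫ x, f x ∂μ = ∫ x, f x * 𝓕 (fun ξ : E => charFun μ ((2 * Real.pi) • ξ)) x := by
  rw [integral_schwartz_eq_integral_fourier]
  have h := VectorFourier.integral_fourierIntegral_smul_eq_flip (μ := (volume : Measure E))
    (ν := (volume : Measure E))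
    (L := innerₗ E) (f := f) (g := fun ξ : E => charFun μ ((2 * Real.pi) • ξ))
    Real.continuous_fourierChar
    (by simp only [innerₗ_apply_apply]; fun_prop) f.integrable hμ
  simp only [smul_eq_mul, flip_innerₗ] at h
  simp_rw [mul_comm (charFun μ _)]
  exact h

/-- Conjugating the Fourier integral and substituting x ↦ -x gives it back. This serves both the
even real bump and Hermitian characteristic functions. -/
lemma fourier_im_eq_zero {g : E → ℂ} (hg : ∀ x, g (-x) = starRingEnd ℂ (g x)) (ξ : E) :
    (𝓕 g ξ).im = 0 := by
  rw [← Complex.conj_eq_iff_im, Real.fourier_eq', ← integral_conj,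
    ← integral_neg_eq_self]
  refine integral_congr_ae (.of_forall fun x => ?_)
  simp only [smul_eq_mul, map_mul, ← Complex.exp_conj, hg, Complex.conj_conj, Complex.conj_ofReal,
    Complex.conj_I, inner_neg_left]
  congr 2
  push_cast
  ring

/-- A compactly supported positive definite kernel. -/
lemma exists_posDef_kernel (E : Type*) [NormedAddCommGroup E] [InnerProductSpace ℝ E]
    [FiniteDimensional ℝ E] [MeasurableSpace E] [BorelSpace E] {δ : ℝ} (hδ : 0 < δ) :
    ∃ (f : 𝓢(E, ℂ)) (G : E → ℝ), (∀ ξ, (𝓕 f : 𝓢(E, ℂ)) ξ = G ξ) ∧ (∀ ξ, 0 ≤ G ξ) ∧ Continuous G ∧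
      0 < G 0 ∧ ∀ x, δ ≤ ‖x‖ → f x = 0 := by
  -- The kernel is b ∗ b: its transform is the square of a real function because b is even, and
  -- outer radius δ/2 makes b ∗ b vanish off B(0, δ).
  let b : ContDiffBump (0 : E) := ⟨δ / 4, δ / 2, by positivity, by linarith⟩
  have hbs : HasCompactSupport (fun x => (b x : ℂ)) :=
    b.hasCompactSupport.comp_left (g := fun r : ℝ => (r : ℂ)) rfl
  obtain ⟨g, hg⟩ : ∃ g : 𝓢(E, ℂ), ∀ x, g x = (b x : ℂ) :=
    ⟨hbs.toSchwartzMap (Complex.ofRealCLM.contDiff.comp b.contDiff), fun _ => rfl⟩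
  have hgr : ∀ ξ, ((𝓕 g : 𝓢(E, ℂ)) ξ).im = 0 := fun ξ => by
    rw [SchwartzMap.fourier_coe]
    exact fourier_im_eq_zero (fun x => by rw [hg, hg, b.neg, Complex.conj_ofReal]) ξ
  refine ⟨SchwartzMap.convolution (ContinuousLinearMap.mul ℂ ℂ) g g,
    fun ξ => ((𝓕 g : 𝓢(E, ℂ)) ξ).re ^ 2, fun ξ => ?_, fun ξ => sq_nonneg _,
    (Complex.continuous_re.comp (𝓕 g : 𝓢(E, ℂ)).continuous).pow 2, ?_, fun x hx => ?_⟩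
  · have h1 : (𝓕 (SchwartzMap.convolution (ContinuousLinearMap.mul ℂ ℂ) g g) : 𝓢(E, ℂ)) ξ
        = (𝓕 g : 𝓢(E, ℂ)) ξ * (𝓕 g : 𝓢(E, ℂ)) ξ := by
      rw [SchwartzMap.fourier_convolution]; rfl
    rw [h1]
    apply Complex.ext
    · simp [hgr, sq]
    · rw [Complex.mul_im, hgr, Complex.ofReal_im]; ring
  · have : (𝓕 g : 𝓢(E, ℂ)) 0 = ((∫ x, b x : ℝ) : ℂ) := by
      rw [SchwartzMap.fourier_coe, Real.fourier_eq']
      simp only [inner_zero_right, mul_zero, Complex.ofReal_zero, zero_mul, Complex.exp_zero,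
        one_smul, hg]
      exact integral_complex_ofReal
    simp only [this, Complex.ofReal_re]
    have := b.integral_pos (μ := volume)
    positivity
  · rw [SchwartzMap.convolution_apply]
    unfold MeasureTheory.convolution
    rw [integral_eq_zero_of_ae]
    refine .of_forall fun t => ?_
    simp only [hg, ContinuousLinearMap.mul_apply', Pi.zero_apply]
    rcases le_or_gt (δ / 2) ‖t‖ with h | h
    · rw [b.zero_of_le_dist (by simpa [b] using h)]; simp
    · rw [b.zero_of_le_dist (x := x - t)]
      · simp
      · have := norm_sub_norm_le x t
        simp only [b, dist_zero_right]; linarith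

/-- A probability measure with nonnegative characteristic function bounded below near `0` charges
every ball around the origin, quantitatively. -/
lemma exists_le_measureReal_ball (E : Type*) [NormedAddCommGroup E] [InnerProductSpace ℝ E]
    [FiniteDimensional ℝ E] [MeasurableSpace E] [BorelSpace E]
    {R δ : ℝ} (hR : 0 < R) (hδ : 0 < δ) :
    ∃ c : ℝ, 0 < c ∧ ∀ (μ : Measure E) (φ : E → ℝ), IsProbabilityMeasure μ →
      (∀ ξ, charFun μ ξ = φ ξ) → (∀ ξ, 0 ≤ φ ξ) →
      (∀ ξ, ‖ξ‖ ≤ R → Real.exp (-1) ≤ φ ξ) → c ≤ μ.real (Metric.ball 0 δ) := by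
  obtain ⟨f, G, hf, hG, hGc, hG0, hfs⟩ := exists_posDef_kernel E hδ
  have hGi : Integrable G := by
    have := (𝓕 f : 𝓢(E, ℂ)).integrable (μ := volume)
    refine (this.re).congr (.of_forall fun ξ => ?_)
    simp [hf]
  let S : Set E := Metric.ball 0 (R / (2 * Real.pi))
  have hI : 0 < ∫ ξ in S, G ξ := by
    rw [setIntegral_pos_iff_support_of_nonneg_ae (.of_forall fun ξ => hG _)
      hGi.integrableOn]
    have ho : IsOpen (Function.support G ∩ S) :=
      (isOpen_ne.preimage hGc).inter Metric.isOpen_ball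
    exact ho.measure_pos _ ⟨0, hG0.ne', Metric.mem_ball_self (by positivity)⟩
  obtain ⟨M, hM⟩ : ∃ M, ∀ x, ‖f x‖ ≤ M := by
    obtain ⟨M, hM⟩ := f.decay 0 0
    exact ⟨M, fun x => by simpa using hM.2 x⟩
  -- From e^{-1} ∫_S G ≤ ∫ φ(2πξ) G = ∫ f dμ ≤ sup|f| · μ(B(0, δ)).
  refine ⟨Real.exp (-1) * (∫ ξ in S, G ξ) / (|M| + 1), by positivity, ?_⟩
  intro μ φ hμ hφ h0 h1
  rw [div_le_iff₀ (by positivity)]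
  have hup : ‖∫ x, f x ∂μ‖ ≤ μ.real (Metric.ball 0 δ) * (|M| + 1) := by
    have : ∫ x, f x ∂μ = ∫ x in Metric.ball 0 δ, f x ∂μ := by
      rw [setIntegral_eq_integral_of_forall_compl_eq_zero]
      intro x hx
      exact hfs x (by simpa using hx)
    rw [this, mul_comm]
    refine norm_setIntegral_le_of_norm_le_const (measure_lt_top _ _) fun x _ => ?_
    linarith [hM x, le_abs_self M]
  refine le_trans ?_ hup
  rw [integral_schwartz_eq_integral_fourier]
  simp_rw [hφ, hf, ← Complex.ofReal_mul]
  rw [integral_complex_ofReal, Complex.norm_real, ← integral_const_mul]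
  refine le_trans ?_ (le_abs_self _)
  have hφm : Measurable fun ξ : E => φ ((2 * Real.pi) • ξ) := by
    have : φ = fun ξ => (charFun μ ξ).re := by ext ξ; simp [hφ]
    rw [this]
    exact Complex.measurable_re.comp (measurable_charFun.comp (by fun_prop))
  have hφ1 : ∀ ξ, φ ξ ≤ 1 := fun ξ => by
    have := norm_charFun_le_one (μ := μ) ξ
    rw [hφ, Complex.norm_real] at this
    exact (le_abs_self _).trans this
  have hφi : Integrable fun ξ : E => φ ((2 * Real.pi) • ξ) * G ξ :=
    hGi.bdd_mul (c := 1) hφm.aestronglyMeasurable (.of_forall fun ξ => by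
      rw [Real.norm_of_nonneg (h0 _)]; exact hφ1 _)
  calc ∫ ξ in S, Real.exp (-1) * G ξ ≤ ∫ ξ in S, φ ((2 * Real.pi) • ξ) * G ξ := by
        refine setIntegral_mono_on (hGi.const_mul _).integrableOn hφi.integrableOn
          Metric.isOpen_ball.measurableSet fun ξ hξ => ?_
        refine mul_le_mul_of_nonneg_right (h1 _ ?_) (hG _)
        rw [norm_smul, Real.norm_of_nonneg (by positivity)]
        have : ‖ξ‖ < R / (2 * Real.pi) := by simpa [S] using hξ
        rw [lt_div_iff₀ (by positivity)] at this
        linarith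
    _ ≤ ∫ ξ, φ ((2 * Real.pi) • ξ) * G ξ :=
        setIntegral_le_integral hφi (.of_forall fun ξ => mul_nonneg (h0 _) (hG _))

/-- Inversion formula: a probability measure with integrable characteristic function has a
continuous nonnegative density. -/
lemma exists_continuous_density (μ : Measure E) [IsProbabilityMeasure μ]
    (hμ : Integrable (charFun μ)) :
    ∃ p : E → ℝ, Continuous p ∧ (∀ x, 0 ≤ p x) ∧
      μ = (volume : Measure E).withDensity (fun x => ENNReal.ofReal (p x)) := by
  have hμ' : Integrable (fun ξ : E => charFun μ ((2 * Real.pi) • ξ)) :=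
    hμ.comp_smul (by positivity)
  let q : E → ℂ := 𝓕 (fun ξ : E => charFun μ ((2 * Real.pi) • ξ))
  have hqc : Continuous q := VectorFourier.fourierIntegral_continuous Real.continuous_fourierChar
    (by simp only [innerₗ_apply_apply]; fun_prop) hμ'
  let p : E → ℝ := fun x => (q x).re
  have hqp : ∀ x, q x = p x := fun x => by
    apply Complex.ext
    · rfl
    · rw [Complex.ofReal_im]
      exact fourier_im_eq_zero (fun ξ => by rw [smul_neg, charFun_neg]) x
  have hpc : Continuous p := Complex.continuous_re.comp hqc
  have keyC (f : E → ℂ) (hf : HasCompactSupport f) (hs : ContDiff ℝ (⊤ : ℕ∞) f) :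
      ∫ x, f x ∂μ = ∫ x, f x * p x := by
    simp_rw [← hqp]
    exact integral_schwartz_eq_integral_mul μ hμ' (hf.toSchwartzMap hs)
  have key (f : E → ℝ) (hf : HasCompactSupport f) (hs : ContDiff ℝ (⊤ : ℕ∞) f) :
      ∫ x, f x ∂μ = ∫ x, f x * p x := by
    have h := keyC (fun x => (f x : ℂ)) (hf.comp_left (g := fun r : ℝ => (r : ℂ)) rfl)
      (Complex.ofRealCLM.contDiff.comp hs)
    simp_rw [← Complex.ofReal_mul] at h
    rw [integral_complex_ofReal, integral_complex_ofReal] at h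
    exact_mod_cast h
  have hp0 : ∀ x, 0 ≤ p x := by
    intro x
    by_contra! hx
    obtain ⟨ε, hε, hε'⟩ := Metric.isOpen_iff.1 (isOpen_lt hpc continuous_const) x hx
    -- A bump supported where p < 0 would have a negative integral against p, yet a nonnegative one
    -- against μ.
    let b : ContDiffBump x := ⟨ε / 2, ε, by positivity, by linarith⟩
    have h := key b b.hasCompactSupport b.contDiff
    have h1 : 0 ≤ ∫ x, b x ∂μ := integral_nonneg fun x => b.nonneg
    have h2 : 0 < ∫ x, b x * (-p x) := by
      have hn : ∀ y, 0 ≤ b y * (-p y) := by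
        intro y
        by_cases hy : y ∈ Metric.ball x ε
        · exact mul_nonneg b.nonneg (neg_nonneg.2 (hε' hy).le)
        · rw [b.zero_of_le_dist (by simpa [b] using hy)]; simp
      have hc : Continuous fun y => b y * (-p y) := b.continuous.mul hpc.neg
      refine hc.integral_pos_of_hasCompactSupport_nonneg_nonzero
        b.hasCompactSupport.mul_right hn (x := x) ?_
      have : b x = 1 := b.one_of_mem_closedBall (Metric.mem_closedBall_self (by positivity))
      rw [this]; linarith
    simp only [mul_neg, integral_neg] at h2
    linarith
  -- Cutoffs exhausting the space extend the identity from test functions first to the total mass of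
  -- p, then to the exponentials e.
  let b : ℕ → ContDiffBump (0 : E) := fun n => ⟨n + 1, n + 2, by positivity, by linarith⟩
  have hb1 : ∀ (n : ℕ) (x : E), ‖x‖ ≤ n → b n x = 1 := fun n x hx =>
    (b n).one_of_mem_closedBall (by simp only [b, mem_closedBall_zero_iff]; linarith)
  have hpi : Integrable p := by
    refine (aecover_closedBall (x := (0 : E)) (r := fun n : ℕ => (n : ℝ))
      tendsto_natCast_atTop_atTop).integrable_of_integral_bounded_of_nonneg_ae 1
      (fun n => hpc.continuousOn.integrableOn_compact (isCompact_closedBall _ _))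
      (.of_forall hp0) (.of_forall fun n => ?_)
    have hi : Integrable fun x => b n x * p x :=
      ((b n).continuous.mul hpc).integrable_of_hasCompactSupport (b n).hasCompactSupport.mul_right
    calc ∫ x in Metric.closedBall 0 (n : ℝ), p x
        = ∫ x in Metric.closedBall 0 (n : ℝ), b n x * p x := by
          refine setIntegral_congr_fun Metric.isClosed_closedBall.measurableSet fun x hx => ?_
          rw [hb1 n x (by simpa using hx), one_mul]
      _ ≤ ∫ x, b n x * p x :=
          setIntegral_le_integral hi (.of_forall fun x => mul_nonneg (b n).nonneg (hp0 x))
      _ = ∫ x, b n x ∂μ := (key _ (b n).hasCompactSupport (b n).contDiff).symm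
      _ ≤ ∫ x, 1 ∂μ := integral_mono_of_nonneg (.of_forall fun x => (b n).nonneg)
          (integrable_const _) (.of_forall fun x => (b n).le_one)
      _ = 1 := by simp
  refine ⟨p, hpc, hp0, ?_⟩
  have hfin : IsFiniteMeasure ((volume : Measure E).withDensity fun x => ENNReal.ofReal (p x)) :=
    isFiniteMeasure_withDensity_ofReal hpi.2
  refine Measure.ext_of_charFun (funext fun ξ => ?_)
  let e : E → ℂ := fun x => Complex.exp (inner ℝ x ξ * Complex.I)
  have he : ContDiff ℝ (⊤ : ℕ∞) e :=
    ((Complex.ofRealCLM.contDiff.comp (contDiff_id.inner ℝ contDiff_const)).mul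
      contDiff_const).cexp
  have hen : ∀ x, ‖e x‖ = 1 := fun x => Complex.norm_exp_ofReal_mul_I _
  have hbt (x : E) : Filter.Tendsto (fun n => (b n x : ℂ)) Filter.atTop (nhds 1) := by
    refine tendsto_const_nhds.congr' ?_
    filter_upwards [Filter.eventually_ge_atTop ⌈‖x‖⌉₊] with n hn
    rw [hb1 n x ((Nat.le_ceil _).trans (by exact_mod_cast hn)), Complex.ofReal_one]
  have hbn (n : ℕ) (x : E) : ‖(b n x : ℂ)‖ ≤ 1 := by
    rw [Complex.norm_real, Real.norm_of_nonneg (b n).nonneg]; exact (b n).le_one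
  have hbc (n : ℕ) : Continuous fun x => (b n x : ℂ) :=
    Complex.continuous_ofReal.comp (b n).continuous
  have h1 : Filter.Tendsto (fun n => ∫ x, (b n x : ℂ) * e x ∂μ) Filter.atTop
      (nhds (charFun μ ξ)) := by
    refine tendsto_integral_of_dominated_convergence (fun _ => 1)
      (fun n => ((hbc n).mul he.continuous).aestronglyMeasurable) (integrable_const _)
      (fun n => .of_forall fun x => ?_) (.of_forall fun x => ?_)
    · rw [norm_mul, hen, mul_one]; exact hbn n x
    · simpa using (hbt x).mul_const (e x)
  have h2 : Filter.Tendsto (fun n => ∫ x, ((b n x : ℂ) * e x) * p x) Filter.atTop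
      (nhds (∫ x, e x * p x)) := by
    refine tendsto_integral_of_dominated_convergence p
      (fun n => (((hbc n).mul he.continuous).mul
        (Complex.continuous_ofReal.comp hpc)).aestronglyMeasurable) hpi
      (fun n => .of_forall fun x => ?_) (.of_forall fun x => ?_)
    · rw [norm_mul, norm_mul, hen, mul_one, Complex.norm_real (p x), Real.norm_of_nonneg (hp0 x)]
      exact mul_le_of_le_one_left (hp0 x) (hbn n x)
    · simpa using ((hbt x).mul_const (e x)).mul_const (p x : ℂ)
  have h3 : charFun μ ξ = ∫ x, e x * p x := by
    refine tendsto_nhds_unique h1 (h2.congr fun n => (keyC _ ?_ ?_).symm)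
    · exact HasCompactSupport.mul_right
        ((b n).hasCompactSupport.comp_left (g := fun r : ℝ => (r : ℂ)) rfl)
    · exact (Complex.ofRealCLM.contDiff.comp (b n).contDiff).mul he
  rw [h3, charFun_apply, integral_withDensity_eq_integral_toReal_smul₀
    (hpc.measurable.ennreal_ofReal).aemeasurable (.of_forall fun x => ENNReal.ofReal_lt_top)]
  refine integral_congr_ae (.of_forall fun x => ?_)
  simp [e, ENNReal.toReal_ofReal (hp0 x), mul_comm]

end Fourier

/-! ### Limits of characteristic functions and compound Poisson laws. -/

section Convolution

variable {E : Type*} [NormedAddCommGroup E] [InnerProductSpace ℝ E] [FiniteDimensional ℝ E]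
  [MeasurableSpace E] [BorelSpace E]

/-- A pointwise limit of characteristic functions which is continuous at the origin is a
characteristic function. -/
lemma exists_charFun_eq_of_tendsto {μ : ℕ → Measure E} [∀ i, IsProbabilityMeasure (μ i)]
    {f : E → ℂ} (hf : ContinuousAt f 0)
    (h : ∀ ξ, Filter.Tendsto (fun n => charFun (μ n) ξ) Filter.atTop (nhds (f ξ))) :
    ∃ ρ : Measure E, IsProbabilityMeasure ρ ∧ ∀ ξ, charFun ρ ξ = f ξ := by
  have ht := isTightMeasureSet_of_tendsto_charFun hf h
  let m : ℕ → ProbabilityMeasure E := fun n => ⟨μ n, inferInstance⟩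
  have hc : IsCompact (closure (Set.range m)) := by
    refine isCompact_closure_of_isTightMeasureSet ?_
    convert ht using 1
    ext ρ
    constructor
    · rintro ⟨_, ⟨n, rfl⟩, rfl⟩
      exact ⟨n, rfl⟩
    · rintro ⟨n, rfl⟩
      exact ⟨m n, ⟨n, rfl⟩, rfl⟩
  -- A limit along a nonprincipal ultrafilter replaces extraction of a subsequence.
  let U : Ultrafilter ℕ := Filter.hyperfilter ℕ
  obtain ⟨ρ, -, hρ⟩ := hc.ultrafilter_le_nhds (U.map m)
    ((Filter.le_principal_iff.2 (Filter.mem_map.2 (by simp))).trans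
      (Filter.monotone_principal subset_closure))
  refine ⟨ρ, inferInstance, fun ξ => ?_⟩
  have h1 : Filter.Tendsto m U (nhds ρ) := hρ
  rw [ProbabilityMeasure.tendsto_iff_forall_integral_rclike_tendsto ℂ] at h1
  have h2 := h1 (BoundedContinuousFunction.innerProbChar ξ)
  simp_rw [← charFun_eq_integral_innerProbChar] at h2
  exact tendsto_nhds_unique h2 ((h ξ).mono_left Nat.hyperfilter_le_atTop)

/-- Convolution powers of a measure. -/
noncomputable def convPow (l : Measure E) : ℕ → Measure E
  | 0 => Measure.dirac 0
  | n + 1 => (convPow l n).conv l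

instance isFiniteMeasure_convPow (l : Measure E) [IsFiniteMeasure l] (n : ℕ) :
    IsFiniteMeasure (convPow l n) := by
  induction n with
  | zero => unfold convPow; infer_instance
  | succ n ih => unfold convPow; infer_instance

lemma convPow_univ (l : Measure E) [IsFiniteMeasure l] (n : ℕ) :
    convPow l n Set.univ = l Set.univ ^ n := by
  induction n with
  | zero => simp [convPow]
  | succ n ih =>
    rw [convPow, Measure.conv, Measure.map_apply (by fun_prop) MeasurableSet.univ,
      Set.preimage_univ, Measure.prod_apply MeasurableSet.univ]
    simp [ih, pow_succ, mul_comm]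

lemma charFun_convPow (l : Measure E) [IsFiniteMeasure l] (n : ℕ) (ξ : E) :
    charFun (convPow l n) ξ = charFun l ξ ^ n := by
  induction n with
  | zero => simp [convPow, charFun_dirac]
  | succ n ih => rw [convPow, charFun_conv, ih, pow_succ]

/-- The compound Poisson distribution with jump intensity `l`. -/
noncomputable def compoundPoisson (l : Measure E) : Measure E :=
  Measure.sum fun k : ℕ =>
    ENNReal.ofReal (Real.exp (-l.real Set.univ) / k.factorial) • convPow l k

instance isProbabilityMeasure_compoundPoisson (l : Measure E) [IsFiniteMeasure l] :
    IsProbabilityMeasure (compoundPoisson l) := by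
  refine ⟨?_⟩
  have hs := (NormedSpace.expSeries_div_hasSum_exp (l.real Set.univ)).mul_left
    (Real.exp (-l.real Set.univ))
  rw [← Real.exp_eq_exp_ℝ, ← Real.exp_add, neg_add_cancel, Real.exp_zero] at hs
  rw [compoundPoisson, Measure.sum_apply _ MeasurableSet.univ, ← ENNReal.ofReal_one, ← hs.tsum_eq,
    ENNReal.ofReal_tsum_of_nonneg (fun n => by positivity) hs.summable]
  refine tsum_congr fun n => ?_
  rw [Measure.smul_apply, convPow_univ, smul_eq_mul, ← ofReal_measureReal,
    ← ENNReal.ofReal_pow (by positivity), ← ENNReal.ofReal_mul (by positivity)]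
  congr 1
  ring

lemma charFun_compoundPoisson (l : Measure E) [IsFiniteMeasure l] (ξ : E) :
    charFun (compoundPoisson l) ξ = Complex.exp (charFun l ξ - l.real Set.univ) := by
  have h : Integrable (fun x => Complex.exp (inner ℝ x ξ * Complex.I)) (compoundPoisson l) := by
    refine (integrable_const (1 : ℝ)).mono' (by fun_prop) (.of_forall fun x => ?_)
    rw [Complex.norm_exp_ofReal_mul_I]
  have h1 := hasSum_integral_measure (by exact h)
  refine h1.unique ?_
  have hs := (NormedSpace.expSeries_div_hasSum_exp (charFun l ξ)).mul_left
    (Complex.exp (-l.real Set.univ))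
  rw [← Complex.exp_eq_exp_ℂ, ← Complex.exp_add, neg_add_eq_sub] at hs
  have e : (fun n : ℕ => ∫ x, Complex.exp (inner ℝ x ξ * Complex.I)
        ∂(ENNReal.ofReal (Real.exp (-l.real Set.univ) / n.factorial) • convPow l n)) =
      fun n : ℕ => Complex.exp (-l.real Set.univ) * (charFun l ξ ^ n / n.factorial) := by
    funext n
    rw [integral_smul_measure, ← charFun_apply, charFun_convPow,
      ENNReal.toReal_ofReal (by positivity), Complex.real_smul]
    push_cast
    ring
  rw [e]
  exact hs

/-- Keeps only the single-jump term k = 1. -/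
lemma le_compoundPoisson (l : Measure E) [IsFiniteMeasure l] :
    ENNReal.ofReal (Real.exp (-l.real Set.univ)) • l ≤ compoundPoisson l := by
  refine le_trans (le_of_eq ?_) (Measure.le_sum _ 1)
  simp [convPow]

end Convolution

/-! ### The exponent Φ, the semigroup, and integrability of e^{-tΦ}. -/

section Exponent

variable {d : ℕ}

/-- Symmetric Lévy measures, of finite or infinite mass. -/
structure IsSymmLevy (ν : Measure (EuclideanSpace ℝ (Fin d))) : Prop where
  levy : ∫⁻ y, ENNReal.ofReal (min 1 (‖y‖ ^ 2)) ∂ν < ∞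
  symm : ∀ D : Set (EuclideanSpace ℝ (Fin d)), MeasurableSet D → ν (-D) = ν D

lemma IsSymmLevyMeasure.isSymmLevy {ν : Measure (EuclideanSpace ℝ (Fin d))}
    (h : IsSymmLevyMeasure ν) : IsSymmLevy ν := ⟨h.levy, h.symm⟩

lemma one_sub_cos_inner_le (ξ y : EuclideanSpace ℝ (Fin d)) :
    1 - Real.cos (inner ℝ ξ y) ≤ (2 + ‖ξ‖ ^ 2) * min 1 (‖y‖ ^ 2) := by
  have h1 := Real.one_sub_sq_div_two_le_cos (x := inner ℝ ξ y)
  have h2 := Real.neg_one_le_cos (inner ℝ ξ y)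
  have h3 : inner ℝ ξ y ^ 2 ≤ ‖ξ‖ ^ 2 * ‖y‖ ^ 2 := by
    rw [← mul_pow, ← sq_abs]
    exact pow_le_pow_left₀ (abs_nonneg _) (abs_real_inner_le_norm ξ y) 2
  rcases min_choice 1 (‖y‖ ^ 2) with h | h <;> rw [h]
  · nlinarith [sq_nonneg ‖ξ‖]
  · nlinarith [sq_nonneg ‖y‖, mul_nonneg (sq_nonneg ‖ξ‖) (sq_nonneg ‖y‖)]

lemma IsSymmLevy.integrable_min {ν : Measure (EuclideanSpace ℝ (Fin d))} (h : IsSymmLevy ν) :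
    Integrable (fun y => min 1 (‖y‖ ^ 2)) ν := by
  refine ⟨by fun_prop, ?_⟩
  rw [hasFiniteIntegral_iff_ofReal (.of_forall fun y => by positivity)]
  exact h.levy

lemma IsSymmLevy.integrable {ν : Measure (EuclideanSpace ℝ (Fin d))} (h : IsSymmLevy ν)
    (ξ : EuclideanSpace ℝ (Fin d)) : Integrable (fun y => 1 - Real.cos (inner ℝ ξ y)) ν := by
  refine (h.integrable_min.const_mul (2 + ‖ξ‖ ^ 2)).mono' (by fun_prop) (.of_forall fun y => ?_)
  rw [Real.norm_of_nonneg (by linarith [Real.cos_le_one (inner ℝ ξ y)])]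
  exact one_sub_cos_inner_le ξ y

lemma levyExponent_nonneg (ν : Measure (EuclideanSpace ℝ (Fin d)))
    (ξ : EuclideanSpace ℝ (Fin d)) : 0 ≤ levyExponent ν ξ :=
  integral_nonneg fun y => by simp [Real.cos_le_one]

lemma IsSymmLevy.levyExponent_le {ν : Measure (EuclideanSpace ℝ (Fin d))} (h : IsSymmLevy ν)
    (ξ : EuclideanSpace ℝ (Fin d)) :
    levyExponent ν ξ ≤ (2 + ‖ξ‖ ^ 2) * ∫ y, min 1 (‖y‖ ^ 2) ∂ν := by
  rw [← integral_const_mul]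
  exact integral_mono (h.integrable ξ) (h.integrable_min.const_mul _)
    (one_sub_cos_inner_le ξ)

/-- Φ must be shown bounded on balls, since a real `sSup` carries no information otherwise. -/
lemma IsSymmLevy.levyExponent_le_levyPsi {ν : Measure (EuclideanSpace ℝ (Fin d))}
    (h : IsSymmLevy ν) {ξ : EuclideanSpace ℝ (Fin d)} {r : ℝ} (hξ : ‖ξ‖ ≤ r) :
    levyExponent ν ξ ≤ levyPsi ν r := by
  refine le_csSup ⟨(2 + r ^ 2) * ∫ y, min 1 (‖y‖ ^ 2) ∂ν, ?_⟩ ⟨ξ, by simpa using hξ, rfl⟩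
  rintro _ ⟨ζ, hζ, rfl⟩
  have hζ' : ‖ζ‖ ≤ r := by simpa using hζ
  refine (h.levyExponent_le ζ).trans (mul_le_mul_of_nonneg_right ?_ ?_)
  · gcongr
  · exact integral_nonneg fun y => by positivity

lemma IsSymmLevy.continuousAt_zero {ν : Measure (EuclideanSpace ℝ (Fin d))}
    (h : IsSymmLevy ν) : ContinuousAt (levyExponent ν) 0 := by
  refine continuousAt_of_dominated (bound := fun y => (2 + 1 ^ 2) * min 1 (‖y‖ ^ 2))
    (.of_forall fun ξ => by fun_prop) ?_ (h.integrable_min.const_mul _)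
    (.of_forall fun y => by fun_prop)
  filter_upwards [Metric.closedBall_mem_nhds (0 : EuclideanSpace ℝ (Fin d)) one_pos] with ξ hξ
  refine .of_forall fun y => ?_
  rw [Real.norm_of_nonneg (by linarith [Real.cos_le_one (inner ℝ ξ y)])]
  refine (one_sub_cos_inner_le ξ y).trans ?_
  have : ‖ξ‖ ≤ 1 := by simpa using hξ
  gcongr

lemma levyExponent_smul (ν : Measure (EuclideanSpace ℝ (Fin d))) (c : ℝ≥0∞)
    (ξ : EuclideanSpace ℝ (Fin d)) : levyExponent (c • ν) ξ = c.toReal * levyExponent ν ξ := by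
  simp [levyExponent, integral_smul_measure]

lemma IsSymmLevy.smul {ν : Measure (EuclideanSpace ℝ (Fin d))} (h : IsSymmLevy ν) {c : ℝ≥0∞}
    (hc : c ≠ ∞) : IsSymmLevy (c • ν) where
  levy := by
    rw [lintegral_smul_measure]
    exact ENNReal.mul_lt_top hc.lt_top h.levy
  symm D hD := by simp [h.symm D hD]

lemma IsSymmLevy.restrict {ν : Measure (EuclideanSpace ℝ (Fin d))} (h : IsSymmLevy ν)
    {S : Set (EuclideanSpace ℝ (Fin d))} (hS : MeasurableSet S) (hS' : -S = S) :
    IsSymmLevy (ν.restrict S) where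
  levy := (lintegral_mono' Measure.restrict_le_self le_rfl).trans_lt h.levy
  symm D hD := by
    rw [Measure.restrict_apply hD, Measure.restrict_apply hD.neg, ← h.symm _ (hD.inter hS),
      Set.inter_neg, hS']

/-- Symmetry kills the sine part, so the compound Poisson exponent of l is minus its Lévy exponent.
-/
lemma charFun_sub_measureReal_univ (l : Measure (EuclideanSpace ℝ (Fin d))) [IsFiniteMeasure l]
    (h : IsSymmLevy l) (ξ : EuclideanSpace ℝ (Fin d)) :
    charFun l ξ - l.real Set.univ = -(levyExponent l ξ : ℂ) := by
  have hi : Integrable (fun x => Complex.exp (inner ℝ x ξ * Complex.I)) l := by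
    refine (integrable_const (1 : ℝ)).mono' (by fun_prop) (.of_forall fun x => ?_)
    rw [Complex.norm_exp_ofReal_mul_I]
  have hm : l.map (fun x => (-1 : ℝ) • x) = l := by
    ext D hD
    rw [Measure.map_apply (by fun_prop) hD, ← h.symm D hD]
    congr 1
    ext x
    simp
  have him : (charFun l ξ).im = 0 := by
    rw [← Complex.conj_eq_iff_im, ← charFun_neg]
    conv_rhs => rw [← hm]
    rw [charFun_map_smul]
    simp
  have hre : (charFun l ξ).re = ∫ x, Real.cos (inner ℝ ξ x) ∂l := by
    have := integral_re hi
    simp only [RCLike.re_eq_complex_re, Complex.exp_ofReal_mul_I_re] at this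
    rw [charFun_apply, ← this]
    simp_rw [real_inner_comm]
  have hc : Integrable (fun x => Real.cos (inner ℝ ξ x)) l := by
    refine (integrable_const (1 : ℝ)).mono' (by fun_prop) (.of_forall fun x => ?_)
    exact Real.abs_cos_le_one _
  have hl : levyExponent l ξ = l.real Set.univ - ∫ x, Real.cos (inner ℝ ξ x) ∂l := by
    rw [levyExponent, integral_sub (integrable_const _) hc]
    simp
  apply Complex.ext
  · simp [hre, hl]
  · simp [him]

/-- The Lévy–Khintchine theorem in the symmetric purely discontinuous case. -/
lemma IsSymmLevy.exists_charFun_eq {ν : Measure (EuclideanSpace ℝ (Fin d))} (h : IsSymmLevy ν) :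
    ∃ ρ : Measure (EuclideanSpace ℝ (Fin d)), IsProbabilityMeasure ρ ∧
      ∀ ξ, charFun ρ ξ = (Real.exp (-levyExponent ν ξ) : ℂ) := by
  -- Symmetric truncations of finite ν-mass that exhaust the complement of 0; the origin does not
  -- matter, as 1 - cos vanishes there.
  let S : ℕ → Set (EuclideanSpace ℝ (Fin d)) := fun n => {y | 1 / ((n : ℝ) + 1) < min 1 (‖y‖ ^ 2)}
  have hSm (n : ℕ) : MeasurableSet (S n) := measurableSet_lt (by fun_prop) (by fun_prop)
  have hSs (n : ℕ) : -S n = S n := by ext y; simp [S]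
  have hfin (n : ℕ) : IsFiniteMeasure (ν.restrict (S n)) := by
    refine ⟨?_⟩
    rw [Measure.restrict_apply_univ]
    exact h.integrable_min.measure_gt_lt_top (by positivity)
  refine exists_charFun_eq_of_tendsto (μ := fun n => compoundPoisson (ν.restrict (S n))) ?_ ?_
  · have := h.continuousAt_zero
    exact Complex.continuous_ofReal.continuousAt.comp
      (Real.continuous_exp.continuousAt.comp this.neg)
  · intro ξ
    simp_rw [charFun_compoundPoisson, charFun_sub_measureReal_univ _ (h.restrict (hSm _) (hSs _)),
      ← Complex.ofReal_neg, ← Complex.ofReal_exp]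
    refine (Complex.continuous_ofReal.tendsto _).comp ((Real.continuous_exp.tendsto _).comp
      (Filter.Tendsto.neg ?_))
    simp_rw [levyExponent, ← integral_indicator (hSm _)]
    refine tendsto_integral_of_dominated_convergence _
      (fun n => (h.integrable ξ).aestronglyMeasurable.indicator (hSm n)) (h.integrable ξ).norm
      (fun n => .of_forall fun y => norm_indicator_le_norm_self _ _) (.of_forall fun y => ?_)
    rcases eq_or_ne y 0 with rfl | hy
    · have : ∀ n, (S n).indicator (fun y => 1 - Real.cos (inner ℝ ξ y)) 0 = (0 : ℝ) := fun n => by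
        simp [Set.indicator_apply]
      simp [this]
    · refine tendsto_const_nhds.congr' ?_
      have hy' : 0 < min 1 (‖y‖ ^ 2) := by
        have := norm_pos_iff.2 hy
        positivity
      filter_upwards [tendsto_one_div_add_atTop_nhds_zero_nat.eventually_lt_const hy'] with n hn
      have hn' : y ∈ S n := hn
      rw [Set.indicator_of_mem hn']

lemma IsSymmLevy.exists_charFun_eq_mul {ν : Measure (EuclideanSpace ℝ (Fin d))}
    (h : IsSymmLevy ν) (t : ℝ≥0) :
    ∃ ρ : Measure (EuclideanSpace ℝ (Fin d)), IsProbabilityMeasure ρ ∧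
      ∀ ξ, charFun ρ ξ = (Real.exp (-(t : ℝ) * levyExponent ν ξ) : ℂ) := by
  obtain ⟨ρ, h1, h2⟩ := (h.smul (c := t) ENNReal.coe_ne_top).exists_charFun_eq
  exact ⟨ρ, h1, fun ξ => by rw [h2, levyExponent_smul]; simp⟩

lemma IsSymmLevy.exists_isLevySemigroup {ν : Measure (EuclideanSpace ℝ (Fin d))}
    (h : IsSymmLevy ν) : ∃ P, IsLevySemigroup ν P := by
  choose P hP hφ using h.exists_charFun_eq_mul
  refine ⟨P, hP, ?_, fun s t => ?_, hφ⟩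
  · refine Measure.ext_of_charFun (funext fun ξ => ?_)
    rw [hφ, charFun_dirac]
    simp
  · refine Measure.ext_of_charFun (funext fun ξ => ?_)
    rw [charFun_conv, hφ, hφ, hφ, ← Complex.ofReal_mul, ← Real.exp_add]
    push_cast
    ring_nf

/-- Under the moment condition, `exp (-t Φ)` is integrable for every `t > 0`. -/
lemma CondA1.integrable_charFun {ν : Measure (EuclideanSpace ℝ (Fin d))} {M₀ : ℝ} {tp : ℝ≥0∞}
    (hA : CondA1 ν M₀ tp) (htp : 0 < tp) {P : ℝ≥0 → Measure (EuclideanSpace ℝ (Fin d))}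
    (hP : IsLevySemigroup ν P) {t : ℝ≥0} (ht : 0 < t) : Integrable (charFun (P t)) := by
  have := hP.prob
  -- (A1) is applied at a time u ≤ t below tp, and e^{-tΦ} ≤ e^{-uΦ} covers all t > 0. The weight
  -- |ξ| only helps for |ξ| > 1; the indicator of the unit ball handles the rest.
  obtain ⟨u, hu0, hu⟩ := ENNReal.lt_iff_exists_nnreal_btwn.1
    (lt_min htp (ENNReal.coe_pos.2 ht))
  have hu1 : 0 < u := by exact_mod_cast hu0
  have hu2 : (u : ℝ≥0∞) < tp := hu.trans_le (min_le_left _ _)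
  have hu3 : u ≤ t := by exact_mod_cast (hu.trans_le (min_le_right _ _)).le
  have hm : Measurable (levyExponent ν) := by
    have : levyExponent ν = fun ξ => -Real.log (charFun (P 1) ξ).re := by
      ext ξ
      rw [hP.charFun_eq, Complex.ofReal_re, Real.log_exp]
      simp
    rw [this]
    exact (Complex.measurable_re.comp measurable_charFun).log.neg
  have h1 : Integrable fun ξ : EuclideanSpace ℝ (Fin d) =>
      Real.exp (-(u : ℝ) * levyExponent ν ξ) * ‖ξ‖ := by
    refine ⟨(by fun_prop : Measurable _).aestronglyMeasurable, ?_⟩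
    rw [hasFiniteIntegral_iff_ofReal (.of_forall fun y => by positivity)]
    exact (hA u hu1 hu2).trans_lt ENNReal.ofReal_lt_top
  have h2 : Integrable ((Metric.closedBall (0 : EuclideanSpace ℝ (Fin d)) 1).indicator
      fun _ => (1 : ℝ)) :=
    (integrable_indicator_iff Metric.isClosed_closedBall.measurableSet).2
      (integrableOn_const (isCompact_closedBall _ _).measure_lt_top.ne)
  refine (h2.add h1).mono' measurable_charFun.aestronglyMeasurable (.of_forall fun ξ => ?_)
  have h3 : Real.exp (-(t : ℝ) * levyExponent ν ξ) ≤ Real.exp (-(u : ℝ) * levyExponent ν ξ) := by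
    have h4 := mul_le_mul_of_nonneg_right (NNReal.coe_le_coe.2 hu3) (levyExponent_nonneg ν ξ)
    exact Real.exp_le_exp.2 (by linarith)
  rw [hP.charFun_eq, Complex.norm_real, Real.norm_of_nonneg (Real.exp_pos _).le, Pi.add_apply]
  by_cases hξ : ‖ξ‖ ≤ 1
  · rw [Set.indicator_of_mem (by simpa using hξ)]
    have : Real.exp (-(t : ℝ) * levyExponent ν ξ) ≤ 1 := by
      rw [Real.exp_le_one_iff]
      have := mul_nonneg t.coe_nonneg (levyExponent_nonneg ν ξ)
      linarith
    have : 0 ≤ Real.exp (-(u : ℝ) * levyExponent ν ξ) * ‖ξ‖ := by positivity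
    linarith
  · rw [Set.indicator_of_notMem (by simpa using hξ)]
    have := le_mul_of_one_le_right (Real.exp_pos (-(u : ℝ) * levyExponent ν ξ)).le (not_le.1 hξ).le
    linarith

end Exponent

/-! ### Lebesgue lower bounds under convolution. -/

section LowerBounds

variable {E : Type*} [NormedAddCommGroup E] [InnerProductSpace ℝ E] [FiniteDimensional ℝ E]
  [MeasurableSpace E] [BorelSpace E]

/-- If `μ` dominates a multiple of Lebesgue measure on `S`, then `μ ∗ ν` dominates a multiple of
Lebesgue measure wherever `ν` charges the translates of the reflection of `S`. -/
lemma smul_restrict_le_conv {μ ν : Measure E} [SFinite μ] [SFinite ν] {S T : Set E}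
    (hS : MeasurableSet S) (hT : MeasurableSet T) {C K : ℝ≥0∞}
    (hμ : C • (volume : Measure E).restrict S ≤ μ) (hK : ∀ z ∈ T, K ≤ ν {y | z - y ∈ S}) :
    (C * K) • (volume : Measure E).restrict T ≤ μ.conv ν := by
  refine Measure.le_iff.2 fun D hD => ?_
  have hadd : MeasurableSet ((fun p : E × E => p.1 + p.2) ⁻¹' D) := measurable_add hD
  rw [Measure.conv, Measure.map_apply (by fun_prop) hD, Measure.prod_apply_symm hadd]
  have hm : Measurable fun p : E × E => S.indicator (fun _ => (1 : ℝ≥0∞)) (p.2 - p.1) *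
      D.indicator (fun _ => 1) p.2 := by
    refine Measurable.mul ?_ ?_
    · exact (measurable_const.indicator hS).comp (by fun_prop)
    · exact (measurable_const.indicator hD).comp (by fun_prop)
  -- Tonelli and translation invariance: the convolution of C · Lebesgue on S with ν has density C
  -- ν{y | z - y ∈ S} at z, at least C K on T.
  calc ((C * K) • (volume : Measure E).restrict T) D
      = C * ∫⁻ _ in T ∩ D, K := by
        rw [Measure.smul_apply, Measure.restrict_apply hD, setLIntegral_const, smul_eq_mul,
          Set.inter_comm, mul_assoc]
    _ ≤ C * ∫⁻ z in T ∩ D, ν {y | z - y ∈ S} := by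
        gcongr 1
        exact setLIntegral_mono' (hT.inter hD) fun z hz => hK z hz.1
    _ ≤ C * ∫⁻ z in D, ν {y | z - y ∈ S} := by
        gcongr 1
        exact lintegral_mono_set Set.inter_subset_right
    _ = C * ∫⁻ z, ∫⁻ y, S.indicator (fun _ => (1 : ℝ≥0∞)) (z - y) *
          D.indicator (fun _ => 1) z ∂ν := by
        rw [← lintegral_indicator hD]
        congr 1
        refine lintegral_congr fun z => ?_
        have hz : MeasurableSet {y | z - y ∈ S} := (by fun_prop : Measurable fun y => z - y) hS
        by_cases h : z ∈ D
        · simp only [h, Set.indicator_of_mem, mul_one]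
          rw [← lintegral_indicator_one hz]
          rfl
        · simp [h]
    _ = C * ∫⁻ y, (∫⁻ z, S.indicator (fun _ => (1 : ℝ≥0∞)) (z - y) *
          D.indicator (fun _ => 1) z) ∂ν := by
        rw [lintegral_lintegral_swap]
        exact (hm.comp measurable_swap).aemeasurable
    _ = ∫⁻ y, C * (∫⁻ z, S.indicator (fun _ => (1 : ℝ≥0∞)) (z - y) *
          D.indicator (fun _ => 1) z) ∂ν := by
        rw [lintegral_const_mul]
        exact hm.lintegral_prod_right'
    _ = ∫⁻ y, (C • (volume : Measure E).restrict S) ((fun x => (x, y)) ⁻¹'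
          ((fun p : E × E => p.1 + p.2) ⁻¹' D)) ∂ν := by
        refine lintegral_congr fun y => ?_
        have hy : MeasurableSet ((fun x : E => (x, y)) ⁻¹' ((fun p : E × E => p.1 + p.2) ⁻¹' D)) :=
          (by fun_prop : Measurable fun x : E => (x, y)) hadd
        rw [Measure.smul_apply, Measure.restrict_apply hy, smul_eq_mul,
          ← lintegral_indicator_one (hy.inter hS),
          ← lintegral_sub_right_eq_self (Set.indicator _ (1 : E → ℝ≥0∞)) y]
        congr 1
        refine lintegral_congr fun z => ?_
        by_cases h1 : z - y ∈ S <;> by_cases h2 : z ∈ D <;> simp [h1, h2]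
    _ ≤ _ := lintegral_mono fun y => hμ _

omit [FiniteDimensional ℝ E] [MeasurableSpace E] [BorelSpace E] in
lemma exists_norm_le_and_norm_sub_le {z : E} {a r : ℝ} (ha : 0 ≤ a) (hr : 0 ≤ r)
    (hz : ‖z‖ ≤ a + r) : ∃ y : E, ‖y‖ ≤ a ∧ ‖z - y‖ ≤ r := by
  rcases le_or_gt ‖z‖ a with h | h
  · exact ⟨z, h, by simpa using hr⟩
  · have hz0 : 0 < ‖z‖ := ha.trans_lt h
    refine ⟨(a / ‖z‖) • z, ?_, ?_⟩
    · rw [norm_smul, Real.norm_of_nonneg (by positivity), div_mul_cancel₀ _ hz0.ne']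
    · have : z - (a / ‖z‖) • z = (1 - a / ‖z‖) • z := by rw [sub_smul, one_smul]
      rw [this, norm_smul, Real.norm_of_nonneg (by rw [sub_nonneg, div_le_one hz0]; exact h.le),
        sub_mul, div_mul_cancel₀ _ hz0.ne']
      linarith

/-- Convolution of two measures dominating multiples of Lebesgue measure on balls. -/
lemma smul_restrict_ball_le_conv {μ ν : Measure E} [SFinite μ] [SFinite ν] {C C' : ℝ≥0∞}
    {r a ε : ℝ} (hr : ε ≤ r) (ha : ε ≤ a)
    (hμ : C • (volume : Measure E).restrict (Metric.ball 0 r) ≤ μ)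
    (hν : C' • (volume : Measure E).restrict (Metric.ball 0 a) ≤ ν) :
    (C * (C' * volume (Metric.ball (0 : E) ε))) •
      (volume : Measure E).restrict (Metric.ball 0 (r + a - 2 * ε)) ≤ μ.conv ν := by
  refine smul_restrict_le_conv Metric.isOpen_ball.measurableSet Metric.isOpen_ball.measurableSet
    hμ fun z hz => ?_
  have hz' : ‖z‖ ≤ (a - ε) + (r - ε) := by
    have : ‖z‖ < r + a - 2 * ε := by simpa using hz
    linarith
  -- Keeping a margin ε in both radii fits a whole ε-ball around y₀ into the overlap; hence the loss
  -- 2ε.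
  obtain ⟨y₀, h1, h2⟩ := exists_norm_le_and_norm_sub_le (sub_nonneg.2 ha) (sub_nonneg.2 hr) hz'
  have hsub : Metric.ball y₀ ε ⊆ {y | z - y ∈ Metric.ball (0 : E) r} ∩ Metric.ball 0 a := by
    intro y hy
    have hy' : ‖y - y₀‖ < ε := by simpa [dist_eq_norm] using hy
    constructor
    · have : ‖z - y‖ ≤ ‖z - y₀‖ + ‖y - y₀‖ := by
        rw [show z - y = (z - y₀) - (y - y₀) by abel]; exact norm_sub_le _ _
      simp only [Set.mem_ofPred_eq, mem_ball_zero_iff]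
      linarith
    · have : ‖y‖ ≤ ‖y₀‖ + ‖y - y₀‖ := by
        conv_lhs => rw [show y = y₀ + (y - y₀) by abel]
        exact norm_add_le _ _
      simp only [mem_ball_zero_iff]
      linarith
  have hm : MeasurableSet {y | z - y ∈ Metric.ball (0 : E) r} :=
    (by fun_prop : Measurable fun y => z - y) Metric.isOpen_ball.measurableSet
  refine le_trans ?_ (hν _)
  rw [Measure.smul_apply, Measure.restrict_apply hm, smul_eq_mul,
    ← Measure.addHaar_ball_center volume y₀ ε]
  gcongr

/-- Pointwise lower bounds for a continuous density. -/
lemma le_of_smul_restrict_ball_le_withDensity {p : E → ℝ} (hp : Continuous p) (hp0 : ∀ x, 0 ≤ p x)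
    {C R : ℝ} (h : ENNReal.ofReal C • (volume : Measure E).restrict (Metric.ball 0 R) ≤
      (volume : Measure E).withDensity fun x => ENNReal.ofReal (p x)) {x : E} (hx : ‖x‖ < R) :
    C ≤ p x := by
  by_contra! hlt
  obtain ⟨c, hc1, hc2⟩ := exists_between hlt
  have ho : IsOpen ({y | p y < c} ∩ Metric.ball 0 R) :=
    (isOpen_lt hp continuous_const).inter Metric.isOpen_ball
  have hpos := ho.measure_pos (volume : Measure E) ⟨x, hc1, by simpa using hx⟩
  have hfin : volume ({y | p y < c} ∩ Metric.ball 0 R) ≠ ∞ :=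
    ((measure_mono Set.inter_subset_right).trans_lt measure_ball_lt_top).ne
  have h1 := h ({y | p y < c} ∩ Metric.ball 0 R)
  rw [Measure.smul_apply, Measure.restrict_apply ho.measurableSet, Set.inter_assoc, Set.inter_self,
    withDensity_apply _ ho.measurableSet, smul_eq_mul] at h1
  have h2 : ∫⁻ y in {y | p y < c} ∩ Metric.ball 0 R, ENNReal.ofReal (p y) ≤
      ENNReal.ofReal c * volume ({y | p y < c} ∩ Metric.ball 0 R) := by
    rw [← setLIntegral_const]
    exact setLIntegral_mono' ho.measurableSet fun y hy => ENNReal.ofReal_le_ofReal hy.1.le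
  have h3 := (ENNReal.mul_le_mul_iff_left hpos.ne' hfin).1 (h1.trans h2)
  rw [ENNReal.ofReal_le_ofReal_iff ((hp0 x).trans hc1.le)] at h3
  linarith

end LowerBounds

/-! ### Chaining along the semigroup. -/

section Semigroup

variable {d : ℕ} {ν : Measure (EuclideanSpace ℝ (Fin d))}
  {P : ℝ≥0 → Measure (EuclideanSpace ℝ (Fin d))}

/-- Chaining of a lower bound on a ball along the semigroup. -/
lemma IsLevySemigroup.smul_restrict_ball_le_nsmul (hP : IsLevySemigroup ν P) {s : ℝ≥0} {C r : ℝ}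
    (hC : 0 ≤ C) (hr : 0 < r)
    (h : ENNReal.ofReal C • volume.restrict (Metric.ball 0 (7 / 8 * r)) ≤ P s) (n : ℕ) :
    ENNReal.ofReal (C ^ (n + 1) *
        volume.real (Metric.ball (0 : EuclideanSpace ℝ (Fin d)) (r / 16)) ^ n) •
      volume.restrict (Metric.ball 0 ((n + 1) * (3 / 4 * r))) ≤ P ((n + 1 : ℕ) * s) := by
  have := hP.prob
  induction n with
  | zero =>
    refine le_trans ?_ (by simpa using h)
    simp only [zero_add, pow_one, pow_zero, mul_one, Nat.cast_zero, one_mul]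
    gcongr ENNReal.ofReal C • volume.restrict ?_
    exact Metric.ball_subset_ball (by linarith)
  | succ n ih =>
    -- Each step adds 7r/8 - 2 · r/16 = 3r/4 to the radius.
    have h1 := smul_restrict_ball_le_conv (ε := r / 16) (by nlinarith [n.cast_nonneg (α := ℝ)])
      (by linarith) ih h
    rw [← ofReal_measureReal, ← ENNReal.ofReal_mul hC, ← ENNReal.ofReal_mul (by positivity)] at h1
    convert h1 using 3
    · ring
    · push_cast; ring_nf
    · rw [← hP.add]
      push_cast; ring_nf

end Semigroup

/-! ### One time step, and the elementary estimates. -/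

section OneStep

variable {d : ℕ} {ν : Measure (EuclideanSpace ℝ (Fin d))}

/-- The part of a Lévy measure given by a multiple of Lebesgue measure on a ball. -/
noncomputable def ballMeasure (d : ℕ) (κ r : ℝ) : Measure (EuclideanSpace ℝ (Fin d)) :=
  ENNReal.ofReal κ • volume.restrict (Metric.ball 0 r)

instance isFiniteMeasure_ballMeasure (κ r : ℝ) : IsFiniteMeasure (ballMeasure d κ r) := by
  have : IsFiniteMeasure ((volume : Measure (EuclideanSpace ℝ (Fin d))).restrict
      (Metric.ball 0 r)) := ⟨by rw [Measure.restrict_apply_univ]; exact measure_ball_lt_top⟩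
  exact Measure.smul_finite _ ENNReal.ofReal_ne_top

lemma measureReal_ball_zero {r : ℝ} (hr : 0 < r) :
    volume.real (Metric.ball (0 : EuclideanSpace ℝ (Fin d)) r) =
      r ^ d * volume.real (Metric.ball (0 : EuclideanSpace ℝ (Fin d)) 1) := by
  rw [measureReal_def, Measure.addHaar_ball_of_pos _ _ hr, finrank_euclideanSpace_fin,
    ENNReal.toReal_mul, ENNReal.toReal_ofReal (by positivity), measureReal_def]

lemma ballMeasure_real_univ {κ r : ℝ} (hκ : 0 < κ) (hr : 0 < r) :
    (ballMeasure d κ r).real Set.univ =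
      κ * (r ^ d * volume.real (Metric.ball (0 : EuclideanSpace ℝ (Fin d)) 1)) := by
  rw [← measureReal_ball_zero hr, ballMeasure, measureReal_def, Measure.smul_apply,
    Measure.restrict_apply_univ, smul_eq_mul, ENNReal.toReal_mul, ENNReal.toReal_ofReal hκ.le,
    measureReal_def]

lemma ballMeasure_symm (κ r : ℝ) (D : Set (EuclideanSpace ℝ (Fin d))) (hD : MeasurableSet D) :
    ballMeasure d κ r (-D) = ballMeasure d κ r D := by
  have : -Metric.ball (0 : EuclideanSpace ℝ (Fin d)) r = Metric.ball 0 r := by ext; simp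
  rw [ballMeasure, Measure.smul_apply, Measure.smul_apply, Measure.restrict_apply hD,
    Measure.restrict_apply hD.neg, ← Measure.measure_neg volume (D ∩ _), Set.inter_neg, this]

lemma ballMeasure_le {κ r : ℝ}
    (h : ∀ᵐ x ∂(volume : Measure (EuclideanSpace ℝ (Fin d))),
      x ∈ Metric.ball (0 : EuclideanSpace ℝ (Fin d)) r → ENNReal.ofReal κ ≤ ν.rnDeriv volume x) :
    ballMeasure d κ r ≤ ν := by
  refine le_trans ?_ (Measure.withDensity_rnDeriv_le ν volume)
  rw [ballMeasure, ← withDensity_const, ← withDensity_indicator Metric.isOpen_ball.measurableSet]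
  refine withDensity_mono ?_
  filter_upwards [h] with x hx
  by_cases hxr : x ∈ Metric.ball 0 r
  · rw [Set.indicator_of_mem hxr]
    exact hx hxr
  · rw [Set.indicator_of_notMem hxr]
    exact zero_le

lemma IsSymmLevy.sub (hν : IsSymmLevy ν) {l : Measure (EuclideanSpace ℝ (Fin d))}
    [IsFiniteMeasure l] (hl : l ≤ ν)
    (hs : ∀ D : Set (EuclideanSpace ℝ (Fin d)), MeasurableSet D → l (-D) = l D) :
    IsSymmLevy (ν - l) where
  levy := (lintegral_mono' Measure.sub_le le_rfl).trans_lt hν.levy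
  symm D hD := by
    rw [Measure.sub_apply hD hl, Measure.sub_apply hD.neg hl, hs D hD, hν.symm D hD]

lemma IsSymmLevy.mono (hν : IsSymmLevy ν) {l : Measure (EuclideanSpace ℝ (Fin d))} (hl : l ≤ ν)
    (hs : ∀ D : Set (EuclideanSpace ℝ (Fin d)), MeasurableSet D → l (-D) = l D) :
    IsSymmLevy l :=
  ⟨(lintegral_mono' hl le_rfl).trans_lt hν.levy, hs⟩

lemma levyExponent_sub_add (hν : IsSymmLevy ν) {l : Measure (EuclideanSpace ℝ (Fin d))}
    [IsFiniteMeasure l] (hl : l ≤ ν) (ξ : EuclideanSpace ℝ (Fin d)) :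
    levyExponent (ν - l) ξ + levyExponent l ξ = levyExponent ν ξ := by
  have h1 : Integrable (fun y => 1 - Real.cos (inner ℝ ξ y)) (ν - l) :=
    (hν.integrable ξ).mono_measure Measure.sub_le
  have h2 : Integrable (fun y => 1 - Real.cos (inner ℝ ξ y)) l := (hν.integrable ξ).mono_measure hl
  rw [levyExponent, levyExponent, levyExponent, ← integral_add_measure h1 h2,
    Measure.sub_add_cancel_of_le hl]

/-- Lower bound for the transition probabilities after a single big jump. -/
lemma IsLevySemigroup.ballMeasure_le {P : ℝ≥0 → Measure (EuclideanSpace ℝ (Fin d))}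
    (hP : IsLevySemigroup ν P) (hν : IsSymmLevy ν) {R c r κ : ℝ} (hr : 0 < r)
    (hκ : 0 < κ)
    (hR : ∀ (μ : Measure (EuclideanSpace ℝ (Fin d))) (φ : EuclideanSpace ℝ (Fin d) → ℝ),
      IsProbabilityMeasure μ → (∀ ξ, charFun μ ξ = φ ξ) → (∀ ξ, 0 ≤ φ ξ) →
      (∀ ξ, ‖ξ‖ ≤ R → Real.exp (-1) ≤ φ ξ) → c ≤ μ.real (Metric.ball 0 (1 / 8)))
    (hl : ballMeasure d κ r ≤ ν) {s : ℝ≥0} (hs : s * levyPsi ν (R / r) ≤ 1) :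
    ENNReal.ofReal (Real.exp (-(s * (κ *
        (r ^ d * volume.real (Metric.ball (0 : EuclideanSpace ℝ (Fin d)) 1))))) * (s * κ) * c) •
      volume.restrict (Metric.ball 0 (7 / 8 * r)) ≤ P s := by
  have hls := ballMeasure_symm (d := d) κ r
  obtain ⟨Q, hQ, hQc⟩ := (hν.sub hl hls).exists_charFun_eq_mul s
  have hsl : IsFiniteMeasure ((s : ℝ≥0∞) • ballMeasure d κ r) :=
    Measure.smul_finite _ ENNReal.coe_ne_top
  have hPs : P s = (compoundPoisson ((s : ℝ≥0∞) • ballMeasure d κ r)).conv Q := by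
    have := hP.prob s
    refine Measure.ext_of_charFun (funext fun ξ => ?_)
    rw [charFun_conv, charFun_compoundPoisson,
      charFun_sub_measureReal_univ _ ((hν.mono hl hls).smul ENNReal.coe_ne_top),
      hQc, hP.charFun_eq, ← Complex.ofReal_neg, ← Complex.ofReal_exp, ← Complex.ofReal_mul,
      ← Real.exp_add, levyExponent_smul, ← levyExponent_sub_add hν hl, ENNReal.coe_toReal]
    ring_nf
  have hball : c ≤ Q.real (Metric.ball 0 (r / 8)) := by
    have hm : Measurable fun x : EuclideanSpace ℝ (Fin d) => r⁻¹ • x := by fun_prop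
    -- Rescaling to unit size keeps c independent of r.
    have h1 := hR (Q.map (fun x => r⁻¹ • x))
      (fun ξ => Real.exp (-(s : ℝ) * levyExponent (ν - ballMeasure d κ r) (r⁻¹ • ξ)))
      (Measure.isProbabilityMeasure_map hm.aemeasurable)
      (fun ξ => by rw [charFun_map_smul, hQc]) (fun ξ => (Real.exp_pos _).le) (fun ξ hξ => ?_)
    · rw [map_measureReal_apply hm Metric.isOpen_ball.measurableSet] at h1
      convert h1 using 2
      ext x
      simp only [mem_ball_zero_iff, Set.mem_preimage, norm_smul, norm_inv,
        Real.norm_of_nonneg hr.le]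
      rw [inv_mul_lt_iff₀ hr]
      ring_nf
    · rw [Real.exp_le_exp]
      have h2 : levyExponent ν (r⁻¹ • ξ) ≤ levyPsi ν (R / r) := by
        refine hν.levyExponent_le_levyPsi ?_
        rw [norm_smul, norm_inv, Real.norm_of_nonneg hr.le, inv_mul_eq_div]
        gcongr
      have h3 := levyExponent_sub_add hν hl (r⁻¹ • ξ)
      have h4 := levyExponent_nonneg (ballMeasure d κ r) (r⁻¹ • ξ)
      have h5 : (s : ℝ) * levyExponent (ν - ballMeasure d κ r) (r⁻¹ • ξ) ≤
          s * levyPsi ν (R / r) := by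
        gcongr
        linarith
      linarith
  have hu : ((s : ℝ≥0∞) • ballMeasure d κ r).real Set.univ =
      s * (κ * (r ^ d * volume.real (Metric.ball (0 : EuclideanSpace ℝ (Fin d)) 1))) := by
    rw [← ballMeasure_real_univ hκ hr, measureReal_def, Measure.smul_apply, smul_eq_mul,
      ENNReal.toReal_mul, ENNReal.coe_toReal, measureReal_def]
  have hcp := le_compoundPoisson ((s : ℝ≥0∞) • ballMeasure d κ r)
  rw [hu] at hcp
  rw [hPs, ENNReal.ofReal_mul (by positivity)]
  refine smul_restrict_le_conv (S := Metric.ball 0 r) Metric.isOpen_ball.measurableSet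
    Metric.isOpen_ball.measurableSet (le_trans (le_of_eq ?_) hcp) fun z hz => ?_
  · rw [ballMeasure, smul_smul, smul_smul, ENNReal.ofReal_mul (by positivity),
      ENNReal.ofReal_mul (by positivity), ENNReal.ofReal_coe_nnreal, mul_assoc]
  · rw [← ofReal_measureReal]
    refine ENNReal.ofReal_le_ofReal (hball.trans (measureReal_mono fun y hy => ?_))
    have hy' : ‖y‖ < r / 8 := by simpa using hy
    have hz' : ‖z‖ < 7 / 8 * r := by simpa using hz
    simp only [Set.mem_ofPred_eq, mem_ball_zero_iff]
    linarith [norm_sub_le z y]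

/-- The dimensional constant in the lower bound of `Ψ` by the density near the origin. -/
lemma exists_mul_le_levyPsi (hd : 1 ≤ d) {R : ℝ} (hR : 0 < R) :
    ∃ K : ℝ, 0 < K ∧ ∀ (ν : Measure (EuclideanSpace ℝ (Fin d))) (κ r : ℝ), IsSymmLevy ν → 0 < κ →
      0 < r → ballMeasure d κ r ≤ ν → κ * r ^ d * K ≤ levyPsi ν (R / r) := by
  let e : EuclideanSpace ℝ (Fin d) := EuclideanSpace.single ⟨0, hd⟩ 1
  have he : ‖e‖ = 1 := by simp [e]
  have hi : IntegrableOn (fun z => 1 - Real.cos (inner ℝ (R • e) z))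
      (Metric.ball (0 : EuclideanSpace ℝ (Fin d)) 1) :=
    (by fun_prop : Continuous fun z => 1 - Real.cos (inner ℝ (R • e) z)).continuousOn
      |>.integrableOn_compact (isCompact_closedBall 0 1) |>.mono_set Metric.ball_subset_closedBall
  -- K comes from evaluating the exponent of the ball part at (R/r)e and substituting y = rz.
  refine ⟨∫ z in Metric.ball (0 : EuclideanSpace ℝ (Fin d)) 1,
    (1 - Real.cos (inner ℝ (R • e) z)), ?_, fun ν κ r hν hκ hr hl => ?_⟩
  · rw [setIntegral_pos_iff_support_of_nonneg_ae
      (.of_forall fun z => by simp [Real.cos_le_one]) hi]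
    have ho : IsOpen (Function.support (fun z => 1 - Real.cos (inner ℝ (R • e) z)) ∩
        Metric.ball 0 1) :=
      (isOpen_ne.preimage (by fun_prop)).inter Metric.isOpen_ball
    -- Puts R a in (0, 1], inside one period, so cos(R a) ≠ 1.
    let a : ℝ := min (1 / 2) (1 / R)
    have ha : 0 < a := by positivity
    have ha1 : a ≤ 1 / 2 := min_le_left _ _
    have ha2 : R * a ≤ 1 := by
      have : a ≤ 1 / R := min_le_right _ _
      rwa [le_div_iff₀ hR, mul_comm] at this
    refine ho.measure_pos _ ⟨a • e, ?_, ?_⟩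
    · have h1 : inner ℝ (R • e) (a • e) = R * a := by
        rw [inner_smul_left, inner_smul_right, real_inner_self_eq_norm_sq, he]; simp
      simp only [Function.mem_support, h1, ne_eq, sub_eq_zero]
      intro h2
      have h3 := (Real.cos_eq_one_iff_of_lt_of_lt (by nlinarith [Real.pi_gt_three])
        (by nlinarith [Real.pi_gt_three])).1 h2.symm
      exact (mul_pos hR ha).ne' h3
    · rw [mem_ball_zero_iff, norm_smul, he, Real.norm_of_nonneg ha.le]
      linarith
  · have h1 : levyExponent (ballMeasure d κ r) ((R / r) • e) =
        κ * r ^ d * ∫ z in Metric.ball (0 : EuclideanSpace ℝ (Fin d)) 1,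
          (1 - Real.cos (inner ℝ (R • e) z)) := by
      have h2 := Measure.setIntegral_comp_smul_of_pos volume
        (fun y => 1 - Real.cos (inner ℝ ((R / r) • e) y))
        (Metric.ball (0 : EuclideanSpace ℝ (Fin d)) 1) hr
      have h3 : ∀ z, inner ℝ ((R / r) • e) (r • z) = inner ℝ (R • e) z := by
        intro z
        rw [inner_smul_left, inner_smul_right, inner_smul_left]
        simp only [conj_trivial]
        field_simp
      simp_rw [h3] at h2
      rw [h2, levyExponent, ballMeasure, integral_smul_measure, ENNReal.toReal_ofReal hκ.le,
        smul_unitBall_of_pos hr, finrank_euclideanSpace_fin]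
      simp only [smul_eq_mul]
      field_simp
    rw [← h1]
    have h2 := levyExponent_sub_add hν hl ((R / r) • e)
    have h3 := levyExponent_nonneg (ν - ballMeasure d κ r) ((R / r) • e)
    have h4 : levyExponent ν ((R / r) • e) ≤ levyPsi ν (R / r) := by
      refine hν.levyExponent_le_levyPsi ?_
      rw [norm_smul, he, mul_one, Real.norm_of_nonneg (by positivity)]
    linarith

/-- Take n + 1 = F = ⌊2u⌋: then 4u/3 < 2(F + 1)/3 ≤ F, as F ≥ 2 when u ≥ 1. -/
lemma exists_nat_floor_bounds {u : ℝ} (hu : 1 ≤ u) :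
    ∃ n : ℕ, ((n : ℝ) + 1) ≤ 2 * u ∧ 4 / 3 * u < n + 1 := by
  have h1 : 2 ≤ ⌊2 * u⌋₊ := Nat.le_floor (by push_cast; linarith)
  have h2 := Nat.lt_floor_add_one (2 * u)
  have h3 := Nat.floor_le (show 0 ≤ 2 * u by linarith)
  obtain ⟨n, hn⟩ := Nat.exists_eq_add_of_le h1
  have h4 : (⌊2 * u⌋₊ : ℝ) = 2 + n := by rw [hn]; push_cast; ring
  refine ⟨n + 1, ?_, ?_⟩
  · push_cast; linarith
  · have : (0 : ℝ) ≤ n := n.cast_nonneg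
    push_cast; linarith

/-- The elementary estimate turning the `n`-fold product into the exponential bound. -/
lemma exp_neg_mul_log_le_pow {u D q c n : ℝ} {m : ℕ} (hm : (m : ℝ) = n) (hn : 0 < n)
    (hnu : n ≤ 2 * u) (hq : 0 < q) (hD : 0 < D) (hc : 2 / q ≤ c) (hc1 : 1 ≤ c * u / D) :
    Real.exp (-(2 * u) * Real.log (c * u / D)) ≤ (q * (D / n)) ^ m := by
  have hL : 0 ≤ Real.log (c * u / D) := Real.log_nonneg hc1
  have hu : 0 < u := by linarith
  have h1 : (q * (D / n))⁻¹ ≤ c * u / D := by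
    rw [mul_inv, inv_div]
    calc q⁻¹ * (n / D) ≤ q⁻¹ * (2 * u / D) := by gcongr
      _ = (2 / q) * u / D := by ring
      _ ≤ c * u / D := by gcongr
  have h2 : -Real.log (c * u / D) ≤ Real.log (q * (D / n)) := by
    rw [neg_le, ← Real.log_inv]
    exact Real.log_le_log (by positivity) h1
  rw [← Real.exp_log (show 0 < q * (D / n) by positivity), ← Real.exp_nat_mul, Real.exp_le_exp, hm]
  -- The logarithm is nonnegative, so n may be replaced by the larger 2u.
  calc -(2 * u) * Real.log (c * u / D) ≤ -n * Real.log (c * u / D) := by nlinarith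
    _ = n * -Real.log (c * u / D) := by ring
    _ ≤ _ := by gcongr

end OneStep

end LevyLower

/-! ### Choice of constants and conclusion. -/

open LevyLower in
theorem mainTheorem9 (d : ℕ) (hd : 1 ≤ d) :
    ∃ c₁ : ℝ, 0 < c₁ ∧ ∀ η : ℝ, 0 < η → ∀ M₀ : ℝ, 0 < M₀ → ∃ c₂ : ℝ, 0 < c₂ ∧
      ∀ ν : Measure (EuclideanSpace ℝ (Fin d)), LevyLower.IsSymmLevyMeasure ν →
      ∀ tp : ℝ≥0∞, 0 < tp → LevyLower.CondA1 ν M₀ tp →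
      ∀ r₀ : ℝ, 0 < r₀ → ∀ κ₀ : ℝ, 0 < κ₀ →
      (∀ᵐ x ∂(volume : Measure (EuclideanSpace ℝ (Fin d))),
        x ∈ Metric.ball (0 : EuclideanSpace ℝ (Fin d)) r₀ →
          ENNReal.ofReal κ₀ ≤ ν.rnDeriv volume x) →
      (∃ P, LevyLower.IsLevySemigroup ν P) ∧
      ∀ P, LevyLower.IsLevySemigroup ν P →
        (∀ t : ℝ≥0, 0 < t → ∃ p, LevyLower.IsContinuousDensity (P t) p) ∧
        ∀ t : ℝ≥0, 0 < t → (t : ℝ≥0∞) < tp →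
          ∀ p, LevyLower.IsContinuousDensity (P t) p →
          ∀ x : EuclideanSpace ℝ (Fin d),
            max r₀ (LevyLower.levyPsi ν (6 * η / r₀) * (3 * r₀ / 4) * (t : ℝ)) ≤ ‖x‖ →
            c₁ * (r₀ ^ d)⁻¹ *
                Real.exp (-(2 * ‖x‖ / r₀) *
                  Real.log (c₂ * ‖x‖ / (r₀ ^ (d + 1) * κ₀ * (t : ℝ))))
              ≤ p x := by
  let v : ℝ := volume.real (Metric.ball (0 : EuclideanSpace ℝ (Fin d)) 1)
  have hv : 0 < v :=
    ENNReal.toReal_pos (Metric.measure_ball_pos _ _ one_pos).ne' measure_ball_lt_top.ne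
  -- B r₀^d is the volume of B(0, r₀/16). The n + 1 steps bring only n such volumes, which explains
  -- the prefactor r₀^{-d}/B.
  let B : ℝ := v / 16 ^ d
  have hB : 0 < B := by positivity
  refine ⟨1 / B, by positivity, fun η hη M₀ _ => ?_⟩
  obtain ⟨c, hc, hR⟩ := exists_le_measureReal_ball (EuclideanSpace ℝ (Fin d))
    (R := 6 * η) (δ := 1 / 8) (by positivity) (by norm_num)
  obtain ⟨K, hK, hKΨ⟩ := exists_mul_le_levyPsi hd (R := 6 * η) (by positivity)
  -- Since s κ₀ r₀^d K ≤ 1, the no-jump factor e^{-s|l|} is at least e^{-v/K}.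
  let A : ℝ := Real.exp (-(v / K)) * c
  have hA : 0 < A := by positivity
  -- The term 2/(AB) bounds the reciprocal of the one-step factor; 2/K makes the argument of the
  -- logarithm at least 1.
  refine ⟨2 / (A * B) + 2 / K, by positivity, fun ν hν' tp htp hA1 r₀ hr₀ κ₀ hκ₀ hrn => ?_⟩
  have hν := hν'.isSymmLevy
  refine ⟨hν.exists_isLevySemigroup, fun P hP => ⟨fun t ht => ?_, fun t ht _ p hp x hx => ?_⟩⟩
  · have := hP.prob t
    obtain ⟨p, h1, h2, h3⟩ := exists_continuous_density (P t) (hA1.integrable_charFun htp hP ht)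
    exact ⟨p, h1, h2, h3⟩
  have ht' : (0 : ℝ) < t := ht
  have hl := ballMeasure_le hrn
  obtain ⟨u, hu⟩ : ∃ u, u = ‖x‖ / r₀ := ⟨_, rfl⟩
  have hxu : ‖x‖ = u * r₀ := by rw [hu, div_mul_cancel₀ _ hr₀.ne']
  have hu1 : 1 ≤ u := by rw [hu, one_le_div hr₀]; exact (le_max_left _ _).trans hx
  obtain ⟨n, hn1, hn2⟩ := exists_nat_floor_bounds hu1
  let s : ℝ≥0 := t / (n + 1 : ℕ)
  have hsr : (s : ℝ) = t / (n + 1) := by simp [s]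
  have hns : ((n + 1 : ℕ) : ℝ≥0) * s = t := mul_div_cancel₀ _ (by positivity)
  have hs0 : (0 : ℝ) < s := by rw [hsr]; positivity
  have hsΨ : s * levyPsi ν (6 * η / r₀) ≤ 1 := by
    have h1 := (le_max_right _ _).trans hx
    have h2 : levyPsi ν (6 * η / r₀) * t ≤ 4 / 3 * u := by
      rw [hxu] at h1
      refine le_of_mul_le_mul_right ?_ hr₀
      linarith
    rw [hsr, div_mul_eq_mul_div, div_le_one (by positivity), mul_comm]
    linarith
  have hκK : s * (κ₀ * r₀ ^ d * K) ≤ 1 :=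
    (mul_le_mul_of_nonneg_left (hKΨ ν κ₀ r₀ hν hκ₀ hr₀ hl) hs0.le).trans hsΨ
  have hstep := hP.ballMeasure_le hν hr₀ hκ₀ hR hl hsΨ
  have hstep' : ENNReal.ofReal (A * (s * κ₀)) • volume.restrict (Metric.ball 0 (7 / 8 * r₀)) ≤
      P s := by
    refine le_trans ?_ hstep
    gcongr ENNReal.ofReal ?_ • _
    have : Real.exp (-(v / K)) ≤ Real.exp (-(s * (κ₀ * (r₀ ^ d * v)))) := by
      rw [Real.exp_le_exp, neg_le_neg_iff, le_div_iff₀ hK]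
      nlinarith
    calc A * (s * κ₀) = Real.exp (-(v / K)) * (s * κ₀) * c := by ring
      _ ≤ _ := by gcongr
  have hchain := hP.smul_restrict_ball_le_nsmul (by positivity) hr₀ hstep' n
  rw [hns, hp.eq_withDensity] at hchain
  have hpx := le_of_smul_restrict_ball_le_withDensity hp.continuous hp.nonneg hchain (x := x)
    (by rw [hxu]; nlinarith)
  refine le_trans ?_ hpx
  rw [measureReal_ball_zero (by positivity)]
  have hlow := exp_neg_mul_log_le_pow (u := u) (D := r₀ ^ d * κ₀ * t) (q := A * B)
    (c := 2 / (A * B) + 2 / K) (n := n + 1) (m := n + 1) (by push_cast; ring) (by positivity) hn1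
    (by positivity) (by positivity) (by linarith [show 0 < 2 / K by positivity]) ?_
  · have e1 : (2 / (A * B) + 2 / K) * ‖x‖ / (r₀ ^ (d + 1) * κ₀ * t) =
        (2 / (A * B) + 2 / K) * u / (r₀ ^ d * κ₀ * t) := by
      rw [hxu, pow_succ]; field_simp
    have e2 : 2 * ‖x‖ / r₀ = 2 * u := by rw [hxu]; field_simp
    rw [e1, e2]
    calc 1 / B * (r₀ ^ d)⁻¹ * _ ≤ 1 / B * (r₀ ^ d)⁻¹ *
          (A * B * (r₀ ^ d * κ₀ * t / (n + 1))) ^ (n + 1) := by gcongr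
      _ = (A * (s * κ₀)) ^ (n + 1) * (B * r₀ ^ d) ^ n := by
          have e3 : A * B * (r₀ ^ d * κ₀ * t / (n + 1)) = (A * (s * κ₀)) * (B * r₀ ^ d) := by
            rw [hsr]; ring
          rw [e3, mul_pow, pow_succ (B * r₀ ^ d)]
          field_simp
      _ = _ := by
          simp only [B, v, div_pow]
          ring
  · rw [le_div_iff₀ (by positivity), one_mul]
    have h1 : r₀ ^ d * κ₀ * t * K ≤ 2 * u := by
      rw [hsr, div_mul_eq_mul_div, div_le_one (by positivity)] at hκK
      linarith
    calc r₀ ^ d * κ₀ * t ≤ 2 * u / K := by rwa [le_div_iff₀ hK]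
      _ = 2 / K * u := by ring
      _ ≤ _ := by
        gcongr
        have : 0 < 2 / (A * B) := by positivity
        linarith
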